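/- Let $a,b>0$ be real numbers. Let $F(a,b;c;t)=\sum_{n\ge 0}\frac{(a,n)(b,n)}{(c,n)}\frac{t^n}{n!}$ $(|t|<1)$ denote the Gaussian hypergeometric function, where $(a,0)=1$ and $(a,n)=a(a+1)\cdots(a+n-1)$ for $n\ge 1$, and let $B(a,b)=\frac{\Gamma(a)\Gamma(b)}{\Gamma(a+b)}$ be the beta function. For $t\in(0,1)$ put $$g(t)=t\,F(a,b;a+b;t),\qquad S(t)=\frac{g(t)}{g(1-\sqrt{1-t})}.$$ (1) If $ab\le 1$, then $1<S(t)\le 2$ for all $t\in(0,1)$. (2) If $\frac1a+\frac1b\le 2$, then $2\le S(t)\le \frac{2}{B(a,b)}$ for all $t\in(0,1)$, and the upper inequality is strict, i.e. $2\le S(t)<\frac{2}{B(a,b)}$, whenever $(a,b)\ne(1,1)$. -/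

import Mathlib

/-- `g(t) = t F(a, b; a + b; t)`, with `F` the Gaussian hypergeometric function; it is only
used for `a, b > 0` and `0 < t < 1`, where the hypergeometric series converges. -/
noncomputable def zeroBalancedG (a b t : ℝ) : ℝ :=
  t * ordinaryHypergeometric a b (a + b) t

/-- `S(t) = g(t) / g(1 - √(1 - t))`. -/
noncomputable def zeroBalancedS (a b t : ℝ) : ℝ :=
  zeroBalancedG a b t / zeroBalancedG a b (1 - √(1 - t))

/-! Write `g(t) = ∑ dₙ tⁿ⁺¹ / (n + 1)` and `x = 1 - √(1 - t)`, so that `t = 2x - x²` and `1 - t = (1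
- x)²`. For `d = 1` this is `-log (1 - t)`, and `g(t) = 2 g(x)` exactly. In general `d₀ = 1`, `dₙ →
1 / B(a, b)`, and `d` is antitone in case (1), monotone in case (2) (`zeroBalancedCoeff_succ_sub`).
Monotonicity of `d` passes to `(1 - t) g'(t)`, which compares `g(t)` with `2 g(x)`
(`two_mul_weightedLogSeries_le`). The upper bound in (2) follows from `1 ≤ dₙ ≤ 1 / B(a, b)` by
comparing `g` with the logarithm. -/

/-- The power series `∑ dₙ tⁿ⁺¹ / (n + 1)`; for `d = 1` its sum is `-log (1 - t)`. -/
noncomputable def weightedLogSeries (d : ℕ → ℝ) (t : ℝ) : ℝ :=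
  ∑' n : ℕ, d n * (t ^ (n + 1) / (n + 1))

/-! ### Series with bounded or monotone weights. -/

section WeightedLogSeries

variable {d : ℕ → ℝ} {M t x : ℝ}

theorem summable_mul_pow_of_bounded (hd : ∀ n, |d n| ≤ M) (ht : |t| < 1) :
    Summable fun n => d n * t ^ n := by
  refine Summable.of_norm_bounded
    ((summable_geometric_of_lt_one (abs_nonneg t) ht).mul_left M) fun n => ?_
  rw [Real.norm_eq_abs, abs_mul, abs_pow]
  exact mul_le_mul_of_nonneg_right (hd n) (by positivity)

theorem summable_weightedLogSeries (hd : ∀ n, |d n| ≤ M) (ht : |t| < 1) :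
    Summable fun n : ℕ => d n * (t ^ (n + 1) / (n + 1)) := by
  have hs := ((Real.hasSum_pow_div_log_of_abs_lt_one (x := |t|) (by simpa using ht)).summable).mul_left M
  refine Summable.of_norm_bounded hs fun n => ?_
  have hn : |(n : ℝ) + 1| = n + 1 := abs_of_pos (by positivity)
  rw [Real.norm_eq_abs, abs_mul, abs_div, abs_pow, hn]
  exact mul_le_mul_of_nonneg_right (hd n) (by positivity)

theorem hasDerivAt_weightedLogSeries (hd : ∀ n, |d n| ≤ M) (ht : |t| < 1) :
    HasDerivAt (weightedLogSeries d) (∑' n, d n * t ^ n) t := by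
  obtain ⟨r, htr, hr⟩ := exists_between ht
  have hr0 : 0 ≤ r := (abs_nonneg t).trans htr.le
  refine hasDerivAt_tsum_of_isPreconnected (g := fun (n : ℕ) y => d n * (y ^ (n + 1) / (n + 1)))
    (g' := fun n y => d n * y ^ n) (u := fun n => M * r ^ n) (t := Set.Ioo (-r) r) (y₀ := t) ((summable_geometric_of_lt_one hr0 hr).mul_left M) isOpen_Ioo isPreconnected_Ioo
    (fun n y _ => ?_) (fun n y hy => ?_) (abs_lt.mp htr) (summable_weightedLogSeries hd ht)
    (abs_lt.mp htr)
  · have hn : (n : ℝ) + 1 ≠ 0 := by positivity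
    refine (((hasDerivAt_pow (n + 1) y).div_const ((n : ℝ) + 1)).const_mul (d n)).congr_deriv ?_
    push_cast
    field_simp
  · rw [Real.norm_eq_abs, abs_mul, abs_pow]
    exact mul_le_mul (hd n) (pow_le_pow_left₀ (abs_nonneg y) (abs_lt.mpr hy).le n)
      (by positivity) ((abs_nonneg _).trans (hd 0))

/-- Summation by parts: for monotone `d` every coefficient after the constant term is nonnegative.
-/
theorem one_sub_mul_tsum_mul_pow (hd : ∀ n, |d n| ≤ M) (ht : |t| < 1) :
    (1 - t) * ∑' n, d n * t ^ n = d 0 + ∑' n, (d (n + 1) - d n) * t ^ (n + 1) := by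
  have hs := summable_mul_pow_of_bounded hd ht
  have hs1 : Summable fun n => d (n + 1) * t ^ (n + 1) := (summable_nat_add_iff 1).mpr hs
  have hs2 : Summable fun n => d n * t ^ (n + 1) :=
    (hs.mul_right t).congr fun n => by ring
  have h2 : ∑' n, d n * t ^ (n + 1) = (∑' n, d n * t ^ n) * t := by
    rw [← tsum_mul_right]; exact tsum_congr fun n => by ring
  have h1 := hs.tsum_eq_zero_add
  simp only [sub_mul]
  rw [hs1.tsum_sub hs2, h2, pow_zero, mul_one] at *
  linarith

theorem monotoneOn_one_sub_mul_tsum (hd : ∀ n, |d n| ≤ M) (hmono : Monotone d) :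
    MonotoneOn (fun t : ℝ => (1 - t) * ∑' n, d n * t ^ n) (Set.Ico 0 1) := by
  intro u hu v hv huv
  have hu1 : |u| < 1 := by rw [abs_of_nonneg hu.1]; exact hu.2
  have hv1 : |v| < 1 := by rw [abs_of_nonneg hv.1]; exact hv.2
  have hs : ∀ {w : ℝ}, |w| < 1 → Summable fun n => (d (n + 1) - d n) * w ^ (n + 1) := by
    intro w hw
    -- One factor `w` is absorbed into the weight to turn the exponent `n + 1` into `n`.
    have hb : ∀ n, |(d (n + 1) - d n) * w| ≤ (M + M) * 1 := fun n => by
      rw [abs_mul]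
      exact mul_le_mul ((abs_sub _ _).trans (add_le_add (hd _) (hd _))) hw.le (abs_nonneg _)
        (by linarith [(abs_nonneg _).trans (hd 0)])
    exact (summable_mul_pow_of_bounded hb hw).congr fun n => by ring
  simp only [one_sub_mul_tsum_mul_pow hd hu1, one_sub_mul_tsum_mul_pow hd hv1]
  refine add_le_add_right ((hs hu1).tsum_le_tsum (fun n => ?_) (hs hv1)) _
  exact mul_le_mul_of_nonneg_left (pow_le_pow_left₀ hu.1 huv _)
    (sub_nonneg.mpr (hmono n.le_succ))

/-- With `f` the sum and `s = 2x - x²`, the derivative of `f(s) - 2 f(x)` times `1 - x` is `2 ((1 -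
s) f'(s) - (1 - x) f'(x))`, nonnegative since `x ≤ s`. -/
theorem two_mul_weightedLogSeries_le (hd : ∀ n, |d n| ≤ M) (hmono : Monotone d)
    (hx : x ∈ Set.Ico (0 : ℝ) 1) :
    2 * weightedLogSeries d x ≤ weightedLogSeries d (2 * x - x ^ 2) := by
  have hmem : ∀ y ∈ Set.Ico (0 : ℝ) 1, 2 * y - y ^ 2 ∈ Set.Ico (0 : ℝ) 1 := fun y hy =>
    ⟨by nlinarith [hy.1, hy.2], by nlinarith [hy.2]⟩
  have habs : ∀ y ∈ Set.Ico (0 : ℝ) 1, |y| < 1 := fun y hy => by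
    rw [abs_of_nonneg hy.1]; exact hy.2
  have hder : ∀ y ∈ Set.Ico (0 : ℝ) 1, HasDerivAt
      (fun y => weightedLogSeries d (2 * y - y ^ 2) - 2 * weightedLogSeries d y)
      ((∑' n, d n * (2 * y - y ^ 2) ^ n) * (2 - 2 * y) - 2 * ∑' n, d n * y ^ n) y := by
    intro y hy
    have hin : HasDerivAt (fun y : ℝ => 2 * y - y ^ 2) (2 - 2 * y) y := by
      refine (((hasDerivAt_id y).const_mul 2).sub (hasDerivAt_pow 2 y)).congr_deriv ?_
      norm_num
    exact ((hasDerivAt_weightedLogSeries hd (habs _ (hmem y hy))).comp y hin).sub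
      ((hasDerivAt_weightedLogSeries hd (habs y hy)).const_mul 2)
  have hm : MonotoneOn
      (fun y => weightedLogSeries d (2 * y - y ^ 2) - 2 * weightedLogSeries d y)
      (Set.Ico 0 1) := by
    refine monotoneOn_of_deriv_nonneg (convex_Ico 0 1)
      (fun y hy => (hder y hy).continuousAt.continuousWithinAt)
      (fun y hy => (hder y (interior_subset hy)).differentiableAt.differentiableWithinAt)
      fun y hy => ?_
    have hy' := interior_subset hy
    rw [(hder y hy').deriv]
    have h1 := monotoneOn_one_sub_mul_tsum hd hmono hy' (hmem y hy')
      (by nlinarith [hy'.1, hy'.2])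
    have hpos : 0 < 1 - y := sub_pos.mpr hy'.2
    simp only at h1
    have h2 : ∑' n, d n * y ^ n ≤ (1 - y) * ∑' n, d n * (2 * y - y ^ 2) ^ n := by
      refine le_of_mul_le_mul_left ?_ hpos
      linarith
    linarith
  have h0 := hm (Set.left_mem_Ico.mpr one_pos) hx hx.1
  have hz : weightedLogSeries d 0 = 0 := by simp [weightedLogSeries]
  simp only [mul_zero, ne_eq, OfNat.ofNat_ne_zero, not_false_eq_true, zero_pow, sub_zero, hz] at h0
  linarith

theorem weightedLogSeries_neg : weightedLogSeries (fun n => -d n) t = -weightedLogSeries d t := by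
  simp only [weightedLogSeries, neg_mul, tsum_neg]

theorem weightedLogSeries_le_two_mul (hd : ∀ n, |d n| ≤ M) (hanti : Antitone d)
    (hx : x ∈ Set.Ico (0 : ℝ) 1) :
    weightedLogSeries d (2 * x - x ^ 2) ≤ 2 * weightedLogSeries d x := by
  have h := two_mul_weightedLogSeries_le (d := fun n => -d n) (M := M)
    (fun n => by simpa using hd n) hanti.neg hx
  simp only [weightedLogSeries_neg] at h
  linarith

theorem weightedLogSeries_pos (hd : ∀ n, |d n| ≤ M) (hpos : ∀ n, 0 < d n)
    (ht : t ∈ Set.Ioo (0 : ℝ) 1) : 0 < weightedLogSeries d t := by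
  have ht0 := ht.1
  exact (summable_weightedLogSeries hd (by rw [abs_of_pos ht.1]; exact ht.2)).tsum_pos
    (fun n => by have := hpos n; positivity) 0 (by have := hpos 0; positivity)

theorem weightedLogSeries_lt_of_lt {u v : ℝ} (hd : ∀ n, |d n| ≤ M) (hpos : ∀ n, 0 < d n)
    (hu : 0 < u) (huv : u < v) (hv : v < 1) : weightedLogSeries d u < weightedLogSeries d v := by
  have hlt : ∀ n : ℕ, d n * (u ^ (n + 1) / (n + 1)) < d n * (v ^ (n + 1) / (n + 1)) := fun n =>
    mul_lt_mul_of_pos_left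
      (div_lt_div_of_pos_right (pow_lt_pow_left₀ huv hu.le n.succ_ne_zero) (by positivity)) (hpos n)
  exact (summable_weightedLogSeries hd (by rw [abs_of_pos hu]; exact huv.trans hv)).tsum_lt_tsum
    (fun n => (hlt n).le) (hlt 0)
    (summable_weightedLogSeries hd (by rw [abs_of_pos (hu.trans huv)]; exact hv))

theorem weightedLogSeries_le_mul_log (hd : ∀ n, |d n| ≤ M) (hle : ∀ n, d n ≤ M)
    (ht : t ∈ Set.Ioo (0 : ℝ) 1) : weightedLogSeries d t ≤ M * -Real.log (1 - t) := by
  have ht1 : |t| < 1 := by rw [abs_of_pos ht.1]; exact ht.2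
  have hlog := (Real.hasSum_pow_div_log_of_abs_lt_one ht1).mul_left M
  have ht0 := ht.1
  rw [← hlog.tsum_eq]
  exact (summable_weightedLogSeries hd ht1).tsum_le_tsum
    (fun n => mul_le_mul_of_nonneg_right (hle n) (by positivity)) hlog.summable

theorem neg_log_le_weightedLogSeries (hd : ∀ n, |d n| ≤ M) (hge : ∀ n, 1 ≤ d n)
    (ht : t ∈ Set.Ioo (0 : ℝ) 1) : -Real.log (1 - t) ≤ weightedLogSeries d t := by
  have ht1 : |t| < 1 := by rw [abs_of_pos ht.1]; exact ht.2
  have hlog := Real.hasSum_pow_div_log_of_abs_lt_one ht1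
  have ht0 := ht.1
  rw [← hlog.tsum_eq]
  exact hlog.summable.tsum_le_tsum
    (fun n => le_mul_of_one_le_left (by positivity) (hge n)) (summable_weightedLogSeries hd ht1)

theorem neg_log_lt_weightedLogSeries (hd : ∀ n, |d n| ≤ M) (hge : ∀ n, 1 ≤ d n)
    (hlt : ∃ n, 1 < d n) (ht : t ∈ Set.Ioo (0 : ℝ) 1) :
    -Real.log (1 - t) < weightedLogSeries d t := by
  have ht1 : |t| < 1 := by rw [abs_of_pos ht.1]; exact ht.2
  have hlog := Real.hasSum_pow_div_log_of_abs_lt_one ht1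
  have ht0 := ht.1
  obtain ⟨m, hm⟩ := hlt
  rw [← hlog.tsum_eq]
  exact hlog.summable.tsum_lt_tsum
    (fun n => le_mul_of_one_le_left (by positivity) (hge n))
    (lt_mul_of_one_lt_left (by positivity) hm) (summable_weightedLogSeries hd ht1)

end WeightedLogSeries

/-! ### The hypergeometric coefficients: monotonicity and limit. -/

/-- The numbers `(n + 1) (a, n) (b, n) / ((a + b, n) n!)`, the Taylor coefficients of the
derivative of `zeroBalancedG a b`. -/
noncomputable def zeroBalancedCoeff (a b : ℝ) (n : ℕ) : ℝ :=
  (n + 1) * ordinaryHypergeometricCoefficient a b (a + b) n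

theorem zeroBalancedG_eq_weightedLogSeries (a b t : ℝ) :
    zeroBalancedG a b t = weightedLogSeries (zeroBalancedCoeff a b) t := by
  rw [zeroBalancedG, ordinaryHypergeometric_eq_tsum, weightedLogSeries, ← tsum_mul_left]
  refine tsum_congr fun n => ?_
  have hn : (n : ℝ) + 1 ≠ 0 := by positivity
  rw [zeroBalancedCoeff, smul_eq_mul, pow_succ]
  field_simp

section ZeroBalancedCoeff

variable {a b : ℝ}

theorem zeroBalancedCoeff_zero : zeroBalancedCoeff a b 0 = 1 := by
  simp [zeroBalancedCoeff, ordinaryHypergeometricCoefficient]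

theorem zeroBalancedCoeff_pos (ha : 0 < a) (hb : 0 < b) (n : ℕ) : 0 < zeroBalancedCoeff a b n := by
  have h1 := ascPochhammer_pos n a ha
  have h2 := ascPochhammer_pos n b hb
  have h3 := ascPochhammer_pos n (a + b) (add_pos ha hb)
  unfold zeroBalancedCoeff ordinaryHypergeometricCoefficient
  positivity

/-- In `(n + 2)(a + n)(b + n) - (n + 1)²(a + b + n)` the cubic and quadratic terms cancel, so the
sign of the increment is that of an affine function of `n`. -/
theorem zeroBalancedCoeff_succ_sub (ha : 0 < a) (hb : 0 < b) (n : ℕ) :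
    zeroBalancedCoeff a b (n + 1) - zeroBalancedCoeff a b n =
      zeroBalancedCoeff a b n * (((a * b - 1) * n + (2 * (a * b) - (a + b))) /
        ((n + 1) ^ 2 * (a + b + n))) := by
  have h3 := (ascPochhammer_pos n (a + b) (add_pos ha hb)).ne'
  have h4 : a + b + n ≠ 0 := by positivity
  have h5 : (n : ℝ) + 1 ≠ 0 := by positivity
  simp only [zeroBalancedCoeff, ordinaryHypergeometricCoefficient, ascPochhammer_succ_eval,
    Nat.factorial_succ]
  push_cast
  field_simp
  ring

theorem antitone_zeroBalancedCoeff (ha : 0 < a) (hb : 0 < b) (h1 : a * b ≤ 1)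
    (h2 : 2 * (a * b) ≤ a + b) : Antitone (zeroBalancedCoeff a b) := by
  refine antitone_nat_of_succ_le fun n => sub_nonpos.mp ?_
  rw [zeroBalancedCoeff_succ_sub ha hb]
  refine mul_nonpos_of_nonneg_of_nonpos (zeroBalancedCoeff_pos ha hb n).le
    (div_nonpos_of_nonpos_of_nonneg ?_ (by positivity))
  have := mul_nonneg (sub_nonneg.mpr h1) (Nat.cast_nonneg (α := ℝ) n)
  linarith

theorem monotone_zeroBalancedCoeff (ha : 0 < a) (hb : 0 < b) (h1 : 1 ≤ a * b)
    (h2 : a + b ≤ 2 * (a * b)) : Monotone (zeroBalancedCoeff a b) := by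
  refine monotone_nat_of_le_succ fun n => sub_nonneg.mp ?_
  rw [zeroBalancedCoeff_succ_sub ha hb]
  refine mul_nonneg (zeroBalancedCoeff_pos ha hb n).le (div_nonneg ?_ (by positivity))
  have := mul_nonneg (sub_nonneg.mpr h1) (Nat.cast_nonneg (α := ℝ) n)
  linarith

theorem exists_one_lt_zeroBalancedCoeff (ha : 0 < a) (hb : 0 < b) (h1 : 1 ≤ a * b)
    (h2 : a + b ≤ 2 * (a * b)) (hne : ¬(a = 1 ∧ b = 1)) : ∃ n, 1 < zeroBalancedCoeff a b n := by
  by_contra! hle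
  have hmono := monotone_zeroBalancedCoeff ha hb h1 h2
  have hone : ∀ n, zeroBalancedCoeff a b n = 1 := fun n =>
    le_antisymm (hle n) (zeroBalancedCoeff_zero.symm.le.trans (hmono n.zero_le))
  have key : ∀ n : ℕ, (a * b - 1) * n + (2 * (a * b) - (a + b)) = 0 := fun n => by
    have h := zeroBalancedCoeff_succ_sub ha hb n
    rw [hone, hone, sub_self, one_mul, eq_comm, div_eq_zero_iff] at h
    exact h.resolve_right (by positivity)
  have k0 := key 0
  have k1 := key 1
  push_cast at k0 k1
  have hab : (a - b) ^ 2 = 0 := by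
    have hp : a * b = 1 := by linarith
    have hs : a + b = 2 := by linarith
    linear_combination (a + b + 2) * hs - 4 * hp
  have := pow_eq_zero_iff (two_ne_zero) |>.mp hab
  exact hne ⟨by linarith, by linarith⟩

open Filter Topology in
-- Euler's limit for `Γ`: in the quotient of the `Real.GammaSeq` the powers of `n` cancel.
theorem tendsto_zeroBalancedCoeff (ha : 0 < a) (hb : 0 < b) :
    Tendsto (zeroBalancedCoeff a b) atTop (𝓝 (1 / ProbabilityTheory.beta a b)) := by
  have hasc : ∀ (s : ℝ) (n : ℕ),
      ∏ j ∈ Finset.range n, (s + j) = (ascPochhammer ℝ n).eval s := by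
    intro s n
    induction n with
    | zero => simp
    | succ n ih => rw [Finset.prod_range_succ, ih, ascPochhammer_succ_eval]
  have hG := ((Real.GammaSeq_tendsto_Gamma (a + b)).div
    ((Real.GammaSeq_tendsto_Gamma a).mul (Real.GammaSeq_tendsto_Gamma b))
    (mul_ne_zero (Real.Gamma_pos_of_pos ha).ne' (Real.Gamma_pos_of_pos hb).ne'))
  have hn : Tendsto (fun n : ℕ => 1 + 1 / ((n : ℝ) + 1)) atTop (𝓝 (1 + 0)) :=
    tendsto_const_nhds.add tendsto_one_div_add_atTop_nhds_zero_nat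
  have hlim := hn.mul hG
  -- `Real.GammaSeq s n` has `n + 1` factors in its denominator, so it matches index `n + 1`; the
  -- leftover factor is `(n + 2) / (n + 1)`.
  rw [← tendsto_add_atTop_iff_nat 1]
  have hval : (1 + 0) * (Real.Gamma (a + b) / (Real.Gamma a * Real.Gamma b)) =
      1 / ProbabilityTheory.beta a b := by
    rw [ProbabilityTheory.beta, one_div_div, add_zero, one_mul]
  rw [hval] at hlim
  refine hlim.congr' ?_
  filter_upwards [eventually_ge_atTop 1] with n hn1
  have hn0 : (0 : ℝ) < n := by exact_mod_cast hn1
  have h1 := (ascPochhammer_pos (n + 1) a ha).ne'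
  have h2 := (ascPochhammer_pos (n + 1) b hb).ne'
  have h3 := (ascPochhammer_pos (n + 1) (a + b) (add_pos ha hb)).ne'
  have h4 := (Real.rpow_pos_of_pos hn0 a).ne'
  have h5 := (Real.rpow_pos_of_pos hn0 b).ne'
  have h6 : (n : ℝ) + 1 ≠ 0 := by positivity
  have h7 : (n.factorial : ℝ) ≠ 0 := by positivity
  simp only [Pi.div_apply, Real.GammaSeq, hasc, Real.rpow_add hn0, zeroBalancedCoeff,
    ordinaryHypergeometricCoefficient, Nat.factorial_succ]
  push_cast
  field_simp

end ZeroBalancedCoeff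

/-! ### The two cases. -/

theorem mainTheorem8 (a b : ℝ) (ha : 0 < a) (hb : 0 < b) :
    (a * b ≤ 1 →
      ∀ t ∈ Set.Ioo (0 : ℝ) 1, 1 < zeroBalancedS a b t ∧ zeroBalancedS a b t ≤ 2) ∧
    (1 / a + 1 / b ≤ 2 →
      ∀ t ∈ Set.Ioo (0 : ℝ) 1,
        2 ≤ zeroBalancedS a b t ∧
        zeroBalancedS a b t ≤ 2 / ProbabilityTheory.beta a b ∧
        (¬(a = 1 ∧ b = 1) → zeroBalancedS a b t < 2 / ProbabilityTheory.beta a b)) := by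
  have hpos := zeroBalancedCoeff_pos ha hb
  have hamgm : 4 * (a * b) ≤ (a + b) ^ 2 := by linarith [sq_nonneg (a - b)]
  have hsub : ∀ t ∈ Set.Ioo (0 : ℝ) 1, ∃ x ∈ Set.Ioo (0 : ℝ) 1,
      1 - √(1 - t) = x ∧ t = 2 * x - x ^ 2 := by
    intro t ht
    have hsq := Real.sq_sqrt (sub_nonneg.mpr ht.2.le)
    have h0 := Real.sqrt_pos.mpr (sub_pos.mpr ht.2)
    have h1 : √(1 - t) < 1 := by
      rw [Real.sqrt_lt' one_pos]; linarith [ht.1]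
    exact ⟨1 - √(1 - t), ⟨by linarith, by linarith⟩, rfl, by linarith⟩
  simp only [zeroBalancedS, zeroBalancedG_eq_weightedLogSeries]
  refine ⟨fun hab t ht => ?_, fun hab t ht => ?_⟩
  · obtain ⟨x, hx, hxt, rfl⟩ := hsub t ht
    rw [hxt]
    -- `(2ab)² ≤ 4ab ≤ (a + b)²`.
    have hs : 2 * (a * b) ≤ a + b := by
      have hp := mul_pos ha hb
      nlinarith
    have hanti := antitone_zeroBalancedCoeff ha hb hab hs
    have hbd : ∀ n, |zeroBalancedCoeff a b n| ≤ 1 := fun n => by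
      rw [abs_of_pos (hpos n)]
      exact (hanti n.zero_le).trans_eq zeroBalancedCoeff_zero
    have hxpos := weightedLogSeries_pos hbd hpos hx
    rw [one_lt_div hxpos, div_le_iff₀ hxpos]
    exact ⟨weightedLogSeries_lt_of_lt hbd hpos hx.1 (by nlinarith [hx.1, hx.2]) ht.2,
      weightedLogSeries_le_two_mul hbd hanti ⟨hx.1.le, hx.2⟩⟩
  · obtain ⟨x, hx, hxt, rfl⟩ := hsub t ht
    rw [hxt]
    have hs : a + b ≤ 2 * (a * b) := by
      rw [div_add_div _ _ ha.ne' hb.ne', div_le_iff₀ (mul_pos ha hb)] at hab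
      linarith
    -- `4ab ≤ (a + b)² ≤ 4(ab)²`.
    have hp : 1 ≤ a * b := by
      nlinarith [mul_pos ha hb]
    have hmono := monotone_zeroBalancedCoeff ha hb hp hs
    have hle : ∀ n, zeroBalancedCoeff a b n ≤ 1 / ProbabilityTheory.beta a b :=
      hmono.ge_of_tendsto (tendsto_zeroBalancedCoeff ha hb)
    have hbd : ∀ n, |zeroBalancedCoeff a b n| ≤ 1 / ProbabilityTheory.beta a b := fun n => by
      rw [abs_of_pos (hpos n)]; exact hle n
    have hge : ∀ n, 1 ≤ zeroBalancedCoeff a b n := fun n =>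
      zeroBalancedCoeff_zero.symm.le.trans (hmono n.zero_le)
    have hxpos := weightedLogSeries_pos hbd hpos hx
    have hB : 0 < 1 / ProbabilityTheory.beta a b :=
      one_div_pos.mpr (ProbabilityTheory.beta_pos ha hb)
    have hup := weightedLogSeries_le_mul_log hbd hle ht
    have hlog : Real.log (1 - (2 * x - x ^ 2)) = 2 * Real.log (1 - x) := by
      rw [show 1 - (2 * x - x ^ 2) = (1 - x) ^ 2 by ring, Real.log_pow]; norm_num
    rw [hlog] at hup
    have h2B : 2 / ProbabilityTheory.beta a b = 1 / ProbabilityTheory.beta a b * 2 := by ring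
    rw [le_div_iff₀ hxpos, div_le_iff₀ hxpos, div_lt_iff₀ hxpos, h2B]
    refine ⟨two_mul_weightedLogSeries_le hbd hmono ⟨hx.1.le, hx.2⟩, ?_, fun hne => ?_⟩
    · have := mul_le_mul_of_nonneg_left (neg_log_le_weightedLogSeries hbd hge hx) hB.le
      linarith
    · have := mul_lt_mul_of_pos_left (neg_log_lt_weightedLogSeries hbd hge
        (exists_one_lt_zeroBalancedCoeff ha hb hp hs hne) hx) hB
      linarith
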